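/- **Instances.** Let $\mathcal A$ be a finite set of applicants and $\mathcal P_0$ a finite set of posts, joined by the edges of a bipartite graph, where each edge $(a,p)$ has a rank $\mathrm{rank}(a,p)\in\{1,\dots,r\}$ (ties are allowed). For each applicant $a$ add a private last-resort post $\ell(a)$, adjacent only to $a$, with $\mathrm{rank}(a,\ell(a))=r+1$. Let $\mathcal P=\mathcal P_0\cup\{\ell(a):a\in\mathcal A\}$, let $G=(\mathcal A\cup\mathcal P,E)$ be the resulting graph, and let $E_i$ be its set of edges of rank $i$, so that $E=E_1\cup\dots\cup E_{r+1}$. The signature of a matching $M$ of $G$ is $(x_1,\dots,x_{r+1})$, where $x_i$ is the number of edges of rank $i$ in $M$; $M$ is *rank-maximal* if its signature is lexicographically maximum among all matchings of $G$. **Even, odd, unreachable.** Let $N$ be a maximum matching of a bipartite graph. A vertex $v$ is *even* (*odd*) if there is an alternating path of even (odd) length from a vertex not matched by $N$ to $v$, and *unreachable* if there is no alternating path from an unmatched vertex to $v$ (the path of length $0$ is allowed). **The graphs $G'_i$ and $G'$.** Let $G'_1=(\mathcal A\cup\mathcal P,E_1)$. For $i=1,\dots,r+1$ choose any maximum matching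 of $G'_i$, and let $\mathcal E_i,\mathcal O_i,\mathcal U_i$ be the sets of even, odd and unreachable vertices that it defines in $G'_i$. For $i\le r$, delete from $E_{i+1}\cup\dots\cup E_{r+1}$ all edges incident on a vertex of $\mathcal O_i\cup\mathcal U_i$, and delete from $G'_i$ all edges between a vertex of $\mathcal O_i$ and a vertex of $\mathcal O_i\cup\mathcal U_i$; adding the remaining edges of $E_{i+1}$ gives $G'_{i+1}$. The reduced graph $G'$ is obtained from $G'_{r+1}$ by deleting all edges between a vertex of $\mathcal O_{r+1}$ and a vertex of $\mathcal O_{r+1}\cup\mathcal U_{r+1}$. **The switching graph.** Let $M$ be a rank-maximal matching of $G$. The switching graph $G_M$ is the directed graph with vertex set $\mathcal P$ that has an edge $(p,p')$ whenever some applicant $a$ satisfies $(a,p)\in M$ and $(a,p')$ is an edge of $G'$; its weight is $\mathrm{rank}(a,p')-\mathrm{rank}(a,p)$. The weight $w(T)$ of a directed path $T$ is the sum of the weights of its edges. A *sink* is a post that has no outgoing edge in $G_M$ and belongs to $\mathcal E_1\cap\dots\cap\mathcal E_{r+1}$. A connected component of the underlying undirected graph of $G_M$ is a *sink component* if it contains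 a sink, and a *non-sink component* otherwise. **Lemma.** For every rank-maximal matching $M$ of $G$ and all choices of the maximum matchings above, the following hold. 1. If a post $p$ is not matched by $M$, then $p\in\mathcal E_1\cap\dots\cap\mathcal E_{r+1}$ and $p$ is a sink of $G_M$. 2. A post $p$ belongs to a sink component of $G_M$ if and only if $p\in\mathcal E_{r+1}$, and it belongs to a non-sink component of $G_M$ if and only if $p\in\mathcal U_{r+1}$. 3. If $T$ is a directed path in $G_M$ from a post $p$ to a sink $q$, then $w(T)=0$ if and only if $p\in\mathcal E_1\cap\dots\cap\mathcal E_{r+1}$. -/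

import Mathlib

/-- An instance of matching under one-sided preferences: a bipartite graph between applicants `A`
and posts `P` in which every edge carries a rank in `{1, …, r}` (ties are allowed). -/
structure PrefInstance (A P : Type*) where
  /-- the number of ranks -/
  r : ℕ
  /-- the post is on the applicant's preference list -/
  adj : A → P → Prop
  /-- the rank of a post for an applicant; only meaningful on edges -/
  rank : A → P → ℕ
  one_le_rank : ∀ a p, adj a p → 1 ≤ rank a p
  rank_le : ∀ a p, adj a p → rank a p ≤ r

/-! ### Matchings and the even / odd / unreachable classification

Edge sets of bipartite graphs with vertex set `A ∪ P` are sets of pairs `(a, p)`. -/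

section Bipartite

variable {A P : Type*}

/-- The graph on the vertex set `A ⊕ P` with the given set of applicant-post edges. -/
def bipGraph (H : Set (A × P)) : SimpleGraph (A ⊕ P) :=
  SimpleGraph.fromEdgeSet {e | ∃ a p, (a, p) ∈ H ∧ e = s(Sum.inl a, Sum.inr p)}

/-- No two edges share an end-point. -/
def IsMatchingSet (M : Set (A × P)) : Prop :=
  ∀ e ∈ M, ∀ f ∈ M, e.1 = f.1 ∨ e.2 = f.2 → e = f

/-- `N` is a maximum (cardinality) matching of the graph with edge set `H`. -/
def IsMaximumMatching (H N : Set (A × P)) : Prop :=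
  N ⊆ H ∧ IsMatchingSet N ∧ ∀ N' ⊆ H, IsMatchingSet N' → N'.ncard ≤ N.ncard

/-- The vertex `v` is not covered by `N`. -/
def IsUnmatched (N : Set (A × P)) (v : A ⊕ P) : Prop :=
  ∀ e ∈ N, v ≠ Sum.inl e.1 ∧ v ≠ Sum.inr e.2

/-- A path of the graph `H` whose edges are alternately inside and outside `N`. -/
def IsAlternatingPath (H N : Set (A × P)) {u v : A ⊕ P} (T : (bipGraph H).Walk u v) : Prop :=
  T.IsPath ∧
    T.edges.IsChain (fun e f => e ∈ (bipGraph N).edgeSet ↔ f ∉ (bipGraph N).edgeSet)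

/-- `v` is even: some alternating path of even length leads from an unmatched vertex to `v`. -/
def IsEvenVertex (H N : Set (A × P)) (v : A ⊕ P) : Prop :=
  ∃ u, IsUnmatched N u ∧
    ∃ T : (bipGraph H).Walk u v, IsAlternatingPath H N T ∧ Even T.length

/-- `v` is odd: some alternating path of odd length leads from an unmatched vertex to `v`. -/
def IsOddVertex (H N : Set (A × P)) (v : A ⊕ P) : Prop :=
  ∃ u, IsUnmatched N u ∧
    ∃ T : (bipGraph H).Walk u v, IsAlternatingPath H N T ∧ Odd T.length

/-- `v` is unreachable: no alternating path leads from an unmatched vertex to `v`. -/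
def IsUnreachableVertex (H N : Set (A × P)) (v : A ⊕ P) : Prop :=
  ∀ u, IsUnmatched N u → ∀ T : (bipGraph H).Walk u v, ¬ IsAlternatingPath H N T

end Bipartite

namespace PrefInstance

variable {A P : Type*}

/-- The edge set `E` of the instance. -/
def edges (J : PrefInstance A P) : Set (A × P) := {e | J.adj e.1 e.2}

/-- Append to every applicant `a` a private last-resort post `ℓ(a) = Sum.inr a`, which is adjacent
to `a` only and is ranked `r + 1` by `a`. -/
def withLastResorts (I : PrefInstance A P) : PrefInstance A (P ⊕ A) where
  r := I.r + 1
  adj a q := Sum.elim (fun p => I.adj a p) (fun b => b = a) q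
  rank a q := Sum.elim (fun p => I.rank a p) (fun _ => I.r + 1) q
  one_le_rank a q h := by
    cases q with
    | inl p => exact I.one_le_rank a p h
    | inr b => exact Nat.le_add_left 1 I.r
  rank_le a q h := by
    cases q with
    | inl p => exact (I.rank_le a p h).trans (Nat.le_succ _)
    | inr b => exact le_rfl

/-- The `i`-th entry of the signature of `M`: the number of applicants that `M` matches to a post
of rank `i`. -/
noncomputable def signature (J : PrefInstance A P) (M : Set (A × P)) (i : ℕ) : ℕ :=
  {e | e ∈ M ∧ J.rank e.1 e.2 = i}.ncard

/-- `M ≻ M'`: the signature of `M` is lexicographically larger than that of `M'`. -/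
def SigGreater (J : PrefInstance A P) (M M' : Set (A × P)) : Prop :=
  ∃ k, 1 ≤ k ∧ k ≤ J.r ∧ (∀ i, 1 ≤ i → i < k → J.signature M i = J.signature M' i) ∧
    J.signature M' k < J.signature M k

/-- `M` is a matching of the instance whose signature is maximum for `≻`. -/
def IsRankMaximal (J : PrefInstance A P) (M : Set (A × P)) : Prop :=
  M ⊆ J.edges ∧ IsMatchingSet M ∧
    ∀ M' ⊆ J.edges, IsMatchingSet M' → ¬ J.SigGreater M' M

/-! ### The algorithm of Irving et al.

`N i` is the maximum matching that is used in iteration `i`. -/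

/-- One iteration, numbered `i`, with `S` the edges not deleted so far. The current graph `G'_i`
consists of the edges of `S` of rank at most `i`, and its vertices are classified by means of the
matching `Ni`. Edges of rank more than `i` incident on an odd or unreachable vertex are deleted,
and so are the edges of `G'_i` between an odd vertex and an odd or unreachable vertex. -/
def iteration (J : PrefInstance A P) (i : ℕ) (Ni S : Set (A × P)) : Set (A × P) :=
  let H : Set (A × P) := {e | e ∈ S ∧ J.rank e.1 e.2 ≤ i}
  let O : A ⊕ P → Prop := IsOddVertex H Ni
  let U : A ⊕ P → Prop := IsUnreachableVertex H Ni
  {e | e ∈ S ∧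
    (i < J.rank e.1 e.2 →
      ¬ ((O (Sum.inl e.1) ∨ U (Sum.inl e.1)) ∨ (O (Sum.inr e.2) ∨ U (Sum.inr e.2)))) ∧
    (J.rank e.1 e.2 ≤ i →
      ¬ ((O (Sum.inl e.1) ∧ (O (Sum.inr e.2) ∨ U (Sum.inr e.2))) ∨
         (O (Sum.inr e.2) ∧ (O (Sum.inl e.1) ∨ U (Sum.inl e.1)))))}

/-- The edges of all ranks that have not been deleted in iterations `1, …, i`. -/
def surviving (J : PrefInstance A P) (N : ℕ → Set (A × P)) : ℕ → Set (A × P)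
  | 0 => J.edges
  | i + 1 => J.iteration (i + 1) (N (i + 1)) (J.surviving N i)

/-- The graph `G'_i` of iteration `i ≥ 1`: the edges of rank at most `i` that have not been deleted
in the iterations before `i`. In particular `G'_1` has edge set `E_1`. -/
def stageGraph (J : PrefInstance A P) (N : ℕ → Set (A × P)) (i : ℕ) : Set (A × P) :=
  {e | e ∈ J.surviving N (i - 1) ∧ J.rank e.1 e.2 ≤ i}

/-- `N 1, …, N r` are possible choices in a run: each `N i` is a maximum matching of `G'_i`. -/
def IsRun (J : PrefInstance A P) (N : ℕ → Set (A × P)) : Prop :=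
  ∀ i, 1 ≤ i → i ≤ J.r → IsMaximumMatching (J.stageGraph N i) (N i)

/-- The reduced graph `G'`: what is left of the graph `G'_i` of the last iteration after deleting
its edges between an odd vertex and an odd or unreachable vertex. -/
def reducedGraph (J : PrefInstance A P) (N : ℕ → Set (A × P)) : Set (A × P) :=
  J.surviving N J.r

/-- The post `p` is in `𝓔_i`. -/
def EvenAt (J : PrefInstance A P) (N : ℕ → Set (A × P)) (i : ℕ) (p : P) : Prop :=
  IsEvenVertex (J.stageGraph N i) (N i) (Sum.inr p)

/-- The post `p` is in `𝓤_i`. -/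
def UnreachableAt (J : PrefInstance A P) (N : ℕ → Set (A × P)) (i : ℕ) (p : P) : Prop :=
  IsUnreachableVertex (J.stageGraph N i) (N i) (Sum.inr p)

/-- The post `p` is in the intersection of the sets `𝓔_i` over all iterations `i`. -/
def AlwaysEven (J : PrefInstance A P) (N : ℕ → Set (A × P)) (p : P) : Prop :=
  ∀ i, 1 ≤ i → i ≤ J.r → J.EvenAt N i p

/-! ### The switching graph -/

/-- The switching graph `G_M` as a directed graph on the posts. -/
def switchingGraph (J : PrefInstance A P) (N : ℕ → Set (A × P)) (M : Set (A × P)) : Digraph P where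
  Adj p q := ∃ a, (a, p) ∈ M ∧ (a, q) ∈ J.reducedGraph N

open Classical in
/-- The weight `rank(a, q) - rank(a, p)` of an edge `(p, q)` of the switching graph, where `a` is
the applicant matched to `p` (with value `0` if there is none, when `(p, q)` is not an edge). -/
noncomputable def weight (J : PrefInstance A P) (M : Set (A × P)) (p q : P) : ℤ :=
  if h : ∃ a, (a, p) ∈ M then (J.rank h.choose q : ℤ) - (J.rank h.choose p : ℤ) else 0

/-- A sink: a post without outgoing edge in `G_M` that is in all the sets `𝓔_i`. -/
def IsSink (J : PrefInstance A P) (N : ℕ → Set (A × P)) (M : Set (A × P)) (p : P) : Prop :=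
  (∀ q, ¬ (J.switchingGraph N M).Adj p q) ∧ J.AlwaysEven N p

/-- The underlying undirected graph of `G_M`. -/
abbrev underlyingGraph (J : PrefInstance A P) (N : ℕ → Set (A × P)) (M : Set (A × P)) :
    SimpleGraph P :=
  (J.switchingGraph N M).toSimpleGraphInclusive

/-- A connected component of the underlying undirected graph that contains a sink. -/
def IsSinkComponent (J : PrefInstance A P) (N : ℕ → Set (A × P)) (M : Set (A × P))
    (X : (J.underlyingGraph N M).ConnectedComponent) : Prop :=
  ∃ q ∈ X.supp, J.IsSink N M q

/-- `T` is the vertex sequence of a directed path in `G_M` from `p` to `q`. -/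
def IsSwitchPath (J : PrefInstance A P) (N : ℕ → Set (A × P)) (M : Set (A × P))
    (p q : P) (T : List P) : Prop :=
  T.IsChain (J.switchingGraph N M).Adj ∧ T.Nodup ∧ T.head? = some p ∧ T.getLast? = some q

/-- The weight of a path: the sum of the weights of its edges. -/
noncomputable def pathWeight (J : PrefInstance A P) (M : Set (A × P)) (T : List P) : ℤ :=
  (List.zipWith (J.weight M) T T.tail).sum

end PrefInstance

/-! ### Alternating walks in bipartite graphs -/

section Bipartite

variable {A P : Type*}

/-! For a maximum matching of a bipartite graph, the non-even applicants with the odd posts, and the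
odd applicants with the non-even posts, are vertex covers of the size of the matching. Tightness in
both covers characterizes maximum matchings (`IsMaximumMatching.iff_covers`): they cover every
non-even vertex and avoid edges between an odd and a non-even vertex. So the classification does not
depend on the matching chosen.

The deletions in stage `j` mirror this criterion: the edges of rank at most `j` of a matching of
undeleted edges are maximum in `G'_j` iff the matching covers all non-even vertices of `G'_j`
(`isMaximumMatching_atMost_iff`). By induction a rank-maximal `M` uses no deleted edge and is
maximum in every stage (`IsRankMaximal.subset_surviving`). Hence unmatched posts are even in all
stages, and sinks are exactly the unmatched posts.

Evenness in the last stage is constant on components of the switching graph, and an alternating path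
from an unmatched post, read backwards, is a switching path to a sink. Last resorts make `M` cover
all applicants, so no post is odd there.

Switching `M` along `T` gives a matching `K` that newly exposes only `p`. The weight of `T` is the
sum over `i` of how far `K` falls short of `M` in edges of rank at most `i` (`exists_switch`). Every
term is nonnegative, and it vanishes iff `p` is even in stage `i`. -/

theorem bipGraph_adj {H : Set (A × P)} {x y : A ⊕ P} :
    (bipGraph H).Adj x y ↔
      ∃ a p, (a, p) ∈ H ∧ (x = .inl a ∧ y = .inr p ∨ x = .inr p ∧ y = .inl a) := by
  simp only [bipGraph, SimpleGraph.fromEdgeSet_adj, Set.mem_ofPred_eq, Sym2.eq_iff]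
  constructor
  · rintro ⟨⟨a, p, h, h'⟩, -⟩
    exact ⟨a, p, h, h'⟩
  · rintro ⟨a, p, h, h'⟩
    refine ⟨⟨a, p, h, h'⟩, ?_⟩
    rcases h' with ⟨rfl, rfl⟩ | ⟨rfl, rfl⟩ <;> simp

@[simp] theorem bipGraph_adj_inl_inr {H : Set (A × P)} {a : A} {p : P} :
    (bipGraph H).Adj (.inl a) (.inr p) ↔ (a, p) ∈ H := by
  simp [bipGraph_adj]

@[simp] theorem bipGraph_adj_inr_inl {H : Set (A × P)} {a : A} {p : P} :
    (bipGraph H).Adj (.inr p) (.inl a) ↔ (a, p) ∈ H := by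
  simp [bipGraph_adj]

@[simp] theorem not_bipGraph_adj_inl_inl {H : Set (A × P)} {a b : A} :
    ¬ (bipGraph H).Adj (.inl a) (.inl b) := by
  simp [bipGraph_adj]

@[simp] theorem not_bipGraph_adj_inr_inr {H : Set (A × P)} {p q : P} :
    ¬ (bipGraph H).Adj (.inr p) (.inr q) := by
  simp [bipGraph_adj]

theorem isUnmatched_inl {N : Set (A × P)} {a : A} :
    IsUnmatched N (.inl a) ↔ ∀ p, (a, p) ∉ N := by
  constructor
  · intro h p hp
    exact (h _ hp).1 rfl
  · rintro h ⟨b, p⟩ hp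
    refine ⟨?_, by simp⟩
    rintro ⟨⟩
    exact h _ hp

theorem isUnmatched_inr {N : Set (A × P)} {p : P} :
    IsUnmatched N (.inr p) ↔ ∀ a, (a, p) ∉ N := by
  constructor
  · intro h a hp
    exact (h _ hp).2 rfl
  · rintro h ⟨a, q⟩ hp
    refine ⟨by simp, ?_⟩
    rintro ⟨⟩
    exact h _ hp

theorem isUnmatched_iff {N : Set (A × P)} {v : A ⊕ P} :
    IsUnmatched N v ↔ ∀ w, ¬ (bipGraph N).Adj v w := by
  rcases v with a | p
  · simp [isUnmatched_inl]
  · simp [isUnmatched_inr]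

theorem IsMatchingSet.adj_unique {N : Set (A × P)} (hN : IsMatchingSet N) {v w w' : A ⊕ P}
    (h : (bipGraph N).Adj v w) (h' : (bipGraph N).Adj v w') : w = w' := by
  rcases v with a | p <;> rcases w with b | q <;> rcases w' with c | s <;> simp at h h'
  · have := hN _ h _ h' (.inl rfl)
    simp_all
  · have := hN _ h _ h' (.inr rfl)
    simp_all

theorem bipGraph_isLeft {H : Set (A × P)} {v w : A ⊕ P} (h : (bipGraph H).Adj v w) :
    v.isLeft = !w.isLeft := by
  rcases v with a | p <;> rcases w with b | q <;> simp at h ⊢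

theorem even_length_iff {H : Set (A × P)} {v w : A ⊕ P} (T : (bipGraph H).Walk v w) :
    Even T.length ↔ v.isLeft = w.isLeft := by
  induction T with
  | nil => simp
  | cons h T ih =>
    rw [SimpleGraph.Walk.length_cons, Nat.even_add_one, ih, bipGraph_isLeft h]
    cases Sum.isLeft _ <;> cases Sum.isLeft _ <;> simp

/-- Alternating reachability from an unmatched vertex; the flag says whether the number of steps
is even. -/
inductive AltReach (H N : Set (A × P)) : Bool → A ⊕ P → Prop
  | base {v} : IsUnmatched N v → AltReach H N true v
  | out {v w} : AltReach H N true v → (bipGraph H).Adj v w → ¬ (bipGraph N).Adj v w →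
      AltReach H N false w
  | back {v w} : AltReach H N false v → (bipGraph N).Adj v w → AltReach H N true w

/-- If the edge lies in `N`, the walk entered `v` through it, so `w` is the predecessor of `v`. -/
theorem AltReach.odd_of_adj {H N : Set (A × P)} (hN : IsMatchingSet N) {v w : A ⊕ P}
    (hv : AltReach H N true v) (h : (bipGraph H).Adj v w) : AltReach H N false w := by
  by_cases hvw : (bipGraph N).Adj v w
  · cases hv with
    | base hu => exact absurd hvw (isUnmatched_iff.1 hu w)
    | back h1 h2 => rwa [← hN.adj_unique h2.symm hvw]
  · exact hv.out h hvw

theorem AltReach.of_walk {H N : Set (A × P)} {x v : A ⊕ P} (T : (bipGraph H).Walk x v)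
    (b : Bool) (hx : AltReach H N b x)
    (hb : ∀ e ∈ T.edges.head?, (e ∈ (bipGraph N).edgeSet ↔ b = false))
    (hT : T.edges.IsChain (fun e f => e ∈ (bipGraph N).edgeSet ↔ f ∉ (bipGraph N).edgeSet)) :
    AltReach H N (if Even T.length then b else !b) v := by
  induction T generalizing b with
  | nil => simpa using hx
  | @cons x y v h T ih =>
    have hxy : (bipGraph N).Adj x y ↔ b = false := by simpa using hb
    have hy : AltReach H N (!b) y := by
      cases b with
      | true => exact hx.out h (by simp [hxy])
      | false => exact hx.back (by simp [hxy])
    rw [SimpleGraph.Walk.edges_cons, List.isChain_cons] at hT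
    have := ih (!b) hy ?_ hT.2
    · rw [SimpleGraph.Walk.length_cons]
      by_cases he : Even T.length <;> simpa [Nat.even_add_one, he] using this
    · intro e he
      have h1 := hT.1 e he
      rw [SimpleGraph.mem_edgeSet, hxy] at h1
      cases b <;> simp_all

/-- A walk that returns to a vertex can be cut at its first visit: in a bipartite graph the parity
is fixed by the sides of the end-points. The condition on edge indices, unlike mere alternation,
also fixes the first edge and passes to prefixes. -/
theorem AltReach.exists_path {H N : Set (A × P)} (hNH : N ⊆ H) {b : Bool} {v : A ⊕ P}
    (hv : AltReach H N b v) :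
    ∃ u, IsUnmatched N u ∧ ∃ T : (bipGraph H).Walk u v, T.IsPath ∧ (Even T.length ↔ b = true) ∧
      ∀ (i : ℕ) (hi : i < T.edges.length), (T.edges[i] ∈ (bipGraph N).edgeSet ↔ Odd i) := by
  classical
  have key : ∀ {b : Bool} {u v w : A ⊕ P} (T : (bipGraph H).Walk u v), T.IsPath →
      (Even T.length ↔ b = true) →
      (∀ (i : ℕ) (hi : i < T.edges.length), (T.edges[i] ∈ (bipGraph N).edgeSet ↔ Odd i)) →
      (bipGraph H).Adj v w → ((bipGraph N).Adj v w ↔ b = false) →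
      ∃ T : (bipGraph H).Walk u w, T.IsPath ∧ (Even T.length ↔ (!b) = true) ∧
      ∀ (i : ℕ) (hi : i < T.edges.length), (T.edges[i] ∈ (bipGraph N).edgeSet ↔ Odd i) := by
    intro b u v w T hp hb hT h hN
    have hpar : ∀ T' : (bipGraph H).Walk u w, (Even T'.length ↔ (!b) = true) := by
      intro T'
      rw [even_length_iff] at hb ⊢
      rw [bipGraph_isLeft h] at hb
      cases b <;> cases hu : u.isLeft <;> cases hw : w.isLeft <;> simp_all
    by_cases hw : w ∈ T.support
    · refine ⟨T.takeUntil w hw, hp.takeUntil hw, hpar _, ?_⟩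
      intro i hi
      have hsp := congrArg SimpleGraph.Walk.edges (T.take_spec hw)
      rw [SimpleGraph.Walk.edges_append] at hsp
      have hi' : i < T.edges.length := by
        rw [← hsp, List.length_append]; omega
      rw [← hT i hi']
      have : T.edges[i] = (T.takeUntil w hw).edges[i] := by
        simp only [← hsp]
        rw [List.getElem_append_left]
      rw [this]
    · refine ⟨T.concat h, hp.concat hw h, hpar _, ?_⟩
      intro i hi
      simp only [SimpleGraph.Walk.edges_concat, List.concat_eq_append]
      rw [List.getElem_append]
      split_ifs with hlt
      · exact hT i hlt
      · simp only [SimpleGraph.Walk.edges_concat, List.concat_eq_append, List.length_append,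
          List.length_singleton] at hi
        have hil : i = T.length := by
          rw [← T.length_edges]; omega
        rw [List.getElem_singleton, SimpleGraph.mem_edgeSet, hN, hil, ← Nat.not_even_iff_odd, hb]
        cases b <;> simp
  induction hv with
  | @base v h => exact ⟨v, h, .nil, by simp, by simp, by simp⟩
  | out _ h h' ih =>
    obtain ⟨u, hu, T, hp, hb, hT⟩ := ih
    exact ⟨u, hu, key T hp hb hT h (by simpa using h')⟩
  | back _ h ih =>
    obtain ⟨u, hu, T, hp, hb, hT⟩ := ih
    refine ⟨u, hu, key T hp hb hT ?_ (by simpa using h)⟩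
    obtain ⟨a, p, hap, h⟩ := bipGraph_adj.1 h
    exact bipGraph_adj.2 ⟨a, p, hNH hap, h⟩

theorem altReach_iff {H N : Set (A × P)} (hNH : N ⊆ H) {b : Bool} {v : A ⊕ P} :
    AltReach H N b v ↔ ∃ u, IsUnmatched N u ∧
      ∃ T : (bipGraph H).Walk u v, IsAlternatingPath H N T ∧ (Even T.length ↔ b = true) := by
  constructor
  · intro h
    obtain ⟨u, hu, T, hp, hb, hT⟩ := h.exists_path hNH
    refine ⟨u, hu, T, ⟨hp, ?_⟩, hb⟩
    rw [List.isChain_iff_getElem]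
    intro i hi
    rw [hT, hT, Nat.not_odd_iff_even, Nat.even_add_one, Nat.not_even_iff_odd]
  · rintro ⟨u, hu, T, ⟨-, hT⟩, hb⟩
    have := AltReach.of_walk T true (.base (H := H) hu) ?_ hT
    · by_cases he : Even T.length
      · simp_all
      · cases b <;> simp_all
    · intro e he
      cases T with
      | nil => simp at he
      | cons h T =>
        simp only [SimpleGraph.Walk.edges_cons, List.head?_cons, Option.mem_def,
          Option.some.injEq] at he
        subst he
        simpa using isUnmatched_iff.1 hu _

theorem isEvenVertex_iff {H N : Set (A × P)} (hNH : N ⊆ H) {v : A ⊕ P} :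
    IsEvenVertex H N v ↔ AltReach H N true v := by
  simp [altReach_iff hNH, IsEvenVertex]

theorem isOddVertex_iff {H N : Set (A × P)} (hNH : N ⊆ H) {v : A ⊕ P} :
    IsOddVertex H N v ↔ AltReach H N false v := by
  simp [altReach_iff hNH, IsOddVertex]

theorem isUnreachableVertex_iff {H N : Set (A × P)} {v : A ⊕ P} :
    IsUnreachableVertex H N v ↔ ¬ IsEvenVertex H N v ∧ ¬ IsOddVertex H N v := by
  constructor
  · intro h
    exact ⟨fun ⟨u, hu, T, hT, _⟩ => h u hu T hT, fun ⟨u, hu, T, hT, _⟩ => h u hu T hT⟩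
  · rintro ⟨h1, h2⟩ u hu T hT
    rcases Nat.even_or_odd T.length with h | h
    · exact h1 ⟨u, hu, T, hT, h⟩
    · exact h2 ⟨u, hu, T, hT, h⟩

end Bipartite

/-! ### Augmenting paths -/

section Bipartite

variable {A P : Type*}

theorem IsMatchingSet.mono {K L : Set (A × P)} (hL : IsMatchingSet L) (h : K ⊆ L) :
    IsMatchingSet K :=
  fun e he f hf => hL e (h he) f (h hf)

theorem IsMatchingSet.insert {K : Set (A × P)} (hK : IsMatchingSet K) {a : A} {p : P}
    (ha : ∀ q, (a, q) ∉ K) (hp : ∀ b, (b, p) ∉ K) : IsMatchingSet (insert (a, p) K) := by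
  rintro ⟨b, q⟩ he ⟨c, s⟩ hf h
  rcases he with he | he <;> rcases hf with hf | hf
  · rw [he, hf]
  · rw [Prod.mk.injEq] at he
    obtain ⟨rfl, rfl⟩ := he
    rcases h with rfl | rfl
    · exact absurd hf (ha _)
    · exact absurd hf (hp _)
  · rw [Prod.mk.injEq] at hf
    obtain ⟨rfl, rfl⟩ := hf
    rcases h with rfl | rfl
    · exact absurd he (ha _)
    · exact absurd he (hp _)
  · exact hK _ he _ hf h

/-- Some alternating walk from the applicant `a` whose first edge is in `H` ends in a post that
`N` leaves unmatched. -/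
inductive ReachesFreePost (H N : Set (A × P)) : A → Prop
  | free {a p} : (a, p) ∈ H → (∀ b, (b, p) ∉ N) → ReachesFreePost H N a
  | step {a p b} : (a, p) ∈ H → (b, p) ∈ N → ReachesFreePost H N b → ReachesFreePost H N a

/-- Cut the walk at its last visit to `p`; what remains avoids `p`. -/
theorem ReachesFreePost.avoid {H N : Set (A × P)} {b : A} (h : ReachesFreePost H N b) (p : P) :
    ReachesFreePost (H \ {e | e.2 = p}) N b ∨ (∀ c, (c, p) ∉ N) ∨
      ∃ c, (c, p) ∈ N ∧ ReachesFreePost (H \ {e | e.2 = p}) N c := by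
  induction h with
  | @free a q h h' =>
    by_cases hq : q = p
    · subst hq; exact .inr (.inl h')
    · exact .inl (.free ⟨h, hq⟩ h')
  | @step a q b h h' _ ih =>
    rcases ih with ih | ih
    · by_cases hq : q = p
      · subst hq; exact .inr (.inr ⟨b, h', ih⟩)
      · exact .inl (.step ⟨h, hq⟩ h' ih)
    · exact .inr ih

theorem ReachesFreePost.exists_first {H N : Set (A × P)} {a : A} (h : ReachesFreePost H N a) :
    ∃ p, (a, p) ∈ H ∧ ((∀ c, (c, p) ∉ N) ∨
      ∃ c, (c, p) ∈ N ∧ ReachesFreePost (H \ {e | e.2 = p}) N c) := by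
  cases h with
  | @free _ p h h' => exact ⟨p, h, .inl h'⟩
  | @step _ p b h h' hb =>
    refine ⟨p, h, ?_⟩
    rcases hb.avoid p with hb | hb
    · exact .inr ⟨b, h', hb⟩
    · exact hb

theorem ReachesFreePost.congr {H N N' : Set (A × P)} {a : A} (h : ReachesFreePost H N a)
    (hN : ∀ b p, (b, p) ∈ H → ∀ c, (c, p) ∈ N ↔ (c, p) ∈ N') : ReachesFreePost H N' a := by
  induction h with
  | free h h' => exact .free h (fun c => by rw [← hN _ _ h]; exact h' c)
  | step h h' _ ih => exact .step h ((hN _ _ h _).1 h') ih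

/-- Augmentation along an alternating path. -/
theorem ReachesFreePost.exists_augmentation [Finite A] [Finite P] {H N : Set (A × P)}
    (hN : IsMatchingSet N) {a : A} (ha : ∀ p, (a, p) ∉ N) (h : ReachesFreePost H N a) :
    ∃ K ⊆ N ∪ H, IsMatchingSet K ∧ N.ncard < K.ncard ∧
      (∃ p, (a, p) ∈ K) ∧ ∀ v, IsUnmatched K v → IsUnmatched N v := by
  induction hn : H.ncard using Nat.strong_induction_on generalizing H N a with
  | _ n ih =>
  obtain ⟨p, hap, hp⟩ := h.exists_first
  rcases hp with hp | ⟨c, hcp, hc⟩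
  · refine ⟨insert (a, p) N, ?_, hN.insert ha hp, ?_, ⟨p, .inl rfl⟩, ?_⟩
    · rintro e (rfl | he)
      · exact .inr hap
      · exact .inl he
    · rw [Set.ncard_insert_of_notMem (ha p)]
      exact Nat.lt_succ_self _
    · exact fun v hv e he => hv e (.inr he)
  have hac : a ≠ c := by rintro rfl; exact ha p hcp
  have hpa : ∀ b, (b, p) ∉ N \ {(c, p)} := by
    rintro b ⟨hb, hb'⟩
    exact hb' (hN _ hb _ hcp (.inr rfl))
  -- Trading `(c, p)` for `(a, p)` exposes `c` instead of `a`. The rest of the walk avoids `p`, so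
  -- it still alternates for `N₁`, in a graph with fewer edges.
  set N₁ := insert (a, p) (N \ {(c, p)}) with hN₁
  have hM₁ : IsMatchingSet N₁ :=
    (hN.mono Set.sdiff_subset).insert (fun q hq => ha q hq.1) hpa
  have hc₁ : ∀ q, (c, q) ∉ N₁ := by
    rintro q (hq | ⟨hq, hq'⟩)
    · exact hac (Prod.mk.injEq .. ▸ hq).1.symm
    · exact hq' (hN _ hq _ hcp (.inl rfl))
  have hcard : N₁.ncard = N.ncard := by
    rw [hN₁, Set.ncard_insert_of_notMem (fun h => ha p h.1), Set.ncard_sdiff_singleton_add_one hcp]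
  have hlt : (H \ {e | e.2 = p}).ncard < n := by
    rw [← hn]
    refine Set.ncard_lt_ncard ⟨Set.sdiff_subset, fun hs => ?_⟩
    exact (hs hap).2 rfl
  have hc' : ReachesFreePost (H \ {e | e.2 = p}) N₁ c := by
    refine hc.congr ?_
    rintro b s ⟨-, hs⟩ d
    have hs : s ≠ p := hs
    simp [hN₁, hs]
  obtain ⟨K, hKs, hK, hKc, ⟨q, hq⟩, hKu⟩ := ih _ hlt hM₁ hc₁ hc' rfl
  refine ⟨K, ?_, hK, hcard ▸ hKc, ?_, ?_⟩
  · intro e he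
    rcases hKs he with (rfl | h) | h
    · exact .inr hap
    · exact .inl h.1
    · exact .inr h.1
  · by_contra! hcon
    exact ((hKu _ (isUnmatched_inl.2 hcon)) (a, p) (.inl rfl)).1 rfl
  · intro v hv e he
    by_cases hec : e = (c, p)
    · subst hec
      exact ⟨(hv _ hq).1, ((hKu v hv) (a, p) (.inl rfl)).2⟩
    · exact hKu v hv e (.inr ⟨he, hec⟩)

/-- Even posts and odd applicants are reached from free posts, even applicants and odd posts from
free applicants. A vertex with both parities would join two such walks into one from a free
applicant to a free post. -/
theorem not_altReach_both {H N : Set (A × P)}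
    (hfree : ∀ a, (∀ p, (a, p) ∉ N) → ¬ ReachesFreePost H N a) (v : A ⊕ P)
    (he : AltReach H N true v) : ¬ AltReach H N false v := by
  have hpost : ∀ {b v}, AltReach H N b v →
      (∀ p, v = .inr p → b = true → (∀ c, (c, p) ∉ N) ∨ ∃ c, (c, p) ∈ N ∧ ReachesFreePost H N c) ∧
      (∀ a, v = .inl a → b = false → ReachesFreePost H N a) := by
    intro b v h
    induction h with
    | base h => exact ⟨by rintro p rfl -; exact .inl (isUnmatched_inr.1 h), by simp⟩
    | @out v w _ h _ ih =>
      refine ⟨by simp, ?_⟩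
      rintro a rfl -
      rcases v with v | p
      · simp at h
      · rcases ih.1 p rfl rfl with h1 | ⟨c, h1, h2⟩
        · exact .free (by simpa using h) h1
        · exact .step (by simpa using h) h1 h2
    | @back v w _ h ih =>
      refine ⟨?_, by simp⟩
      rintro p rfl -
      rcases v with a | v
      · exact .inr ⟨a, by simpa using h, ih.2 a rfl rfl⟩
      · simp at h
  have happ : ∀ {b v}, AltReach H N b v →
      (∀ a, v = .inl a → b = true → ¬ ReachesFreePost H N a) ∧
      (∀ p, v = .inr p → b = false →
        ¬ ((∀ c, (c, p) ∉ N) ∨ ∃ c, (c, p) ∈ N ∧ ReachesFreePost H N c)) := by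
    intro b v h
    induction h with
    | base h => exact ⟨by rintro a rfl -; exact hfree a (isUnmatched_inl.1 h), by simp⟩
    | @out v w _ h _ ih =>
      refine ⟨by simp, ?_⟩
      rintro p rfl - hcon
      rcases v with a | v
      · refine ih.1 a rfl rfl ?_
        rcases hcon with h1 | ⟨c, h1, h2⟩
        · exact .free (by simpa using h) h1
        · exact .step (by simpa using h) h1 h2
      · simp at h
    | @back v w _ h ih =>
      refine ⟨?_, by simp⟩
      rintro a rfl - hcon
      rcases v with v | p
      · simp at h
      · exact ih.2 p rfl rfl (.inr ⟨a, by simpa using h, hcon⟩)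
  intro ho
  rcases v with a | p
  · exact (happ he).1 a rfl rfl ((hpost ho).2 a rfl rfl)
  · exact (happ ho).2 p rfl rfl ((hpost he).1 p rfl rfl)

/-! ### Vertex covers and tightness -/

/-- Double counting of the pairs of an edge of `K` and one of its end-points in a vertex cover. -/
theorem IsMatchingSet.ncard_cover [Finite A] [Finite P] {K : Set (A × P)} (hK : IsMatchingSet K)
    (CA : Set A) (CP : Set P) (hC : ∀ e ∈ K, e.1 ∈ CA ∨ e.2 ∈ CP) :
    K.ncard + {e | e ∈ K ∧ e.1 ∈ CA ∧ e.2 ∈ CP}.ncard + {a | a ∈ CA ∧ ∀ p, (a, p) ∉ K}.ncard +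
      {p | p ∈ CP ∧ ∀ a, (a, p) ∉ K}.ncard = CA.ncard + CP.ncard := by
  have h1 : {e | e ∈ K ∧ e.1 ∈ CA}.ncard + {a | a ∈ CA ∧ ∀ p, (a, p) ∉ K}.ncard = CA.ncard := by
    rw [← Set.InjOn.ncard_image (f := Prod.fst) (s := {e | e ∈ K ∧ e.1 ∈ CA})
      (fun e he f hf h => hK e he.1 f hf.1 (.inl h)), ← Set.ncard_union_eq]
    · congr 1
      ext a
      constructor
      · rintro (⟨e, he, rfl⟩ | h)
        · exact he.2
        · exact h.1
      · intro ha
        by_cases h : ∀ p, (a, p) ∉ K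
        · exact .inr ⟨ha, h⟩
        · push Not at h
          obtain ⟨p, hp⟩ := h
          exact .inl ⟨(a, p), ⟨hp, ha⟩, rfl⟩
    · rw [Set.disjoint_left]
      rintro _ ⟨⟨a, p⟩, he, rfl⟩ h
      exact h.2 p he.1
  have h2 : {e | e ∈ K ∧ e.2 ∈ CP}.ncard + {p | p ∈ CP ∧ ∀ a, (a, p) ∉ K}.ncard = CP.ncard := by
    rw [← Set.InjOn.ncard_image (f := Prod.snd) (s := {e | e ∈ K ∧ e.2 ∈ CP})
      (fun e he f hf h => hK e he.1 f hf.1 (.inr h)), ← Set.ncard_union_eq]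
    · congr 1
      ext p
      constructor
      · rintro (⟨e, he, rfl⟩ | h)
        · exact he.2
        · exact h.1
      · intro hp
        by_cases h : ∀ a, (a, p) ∉ K
        · exact .inr ⟨hp, h⟩
        · push Not at h
          obtain ⟨a, ha⟩ := h
          exact .inl ⟨(a, p), ⟨ha, hp⟩, rfl⟩
    · rw [Set.disjoint_left]
      rintro _ ⟨⟨a, p⟩, he, rfl⟩ h
      exact h.2 a he.1
  have h3 := Set.ncard_union_add_ncard_inter {e | e ∈ K ∧ e.1 ∈ CA} {e | e ∈ K ∧ e.2 ∈ CP}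
  have h4 : {e | e ∈ K ∧ e.1 ∈ CA} ∪ {e | e ∈ K ∧ e.2 ∈ CP} = K := by
    ext e
    constructor
    · rintro (h | h) <;> exact h.1
    · intro h
      rcases hC e h with h' | h'
      · exact .inl ⟨h, h'⟩
      · exact .inr ⟨h, h'⟩
  have h5 : {e | e ∈ K ∧ e.1 ∈ CA} ∩ {e | e ∈ K ∧ e.2 ∈ CP} =
      {e | e ∈ K ∧ e.1 ∈ CA ∧ e.2 ∈ CP} := by
    ext e
    constructor
    · rintro ⟨h, h'⟩
      exact ⟨h.1, h.2, h'.2⟩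
    · rintro ⟨h, h1, h2⟩
      exact ⟨⟨h, h1⟩, h, h2⟩
  rw [h4, h5] at h3
  omega

theorem IsMatchingSet.ncard_le_cover [Finite A] [Finite P] {K : Set (A × P)}
    (hK : IsMatchingSet K) (CA : Set A) (CP : Set P) (hC : ∀ e ∈ K, e.1 ∈ CA ∨ e.2 ∈ CP) :
    K.ncard ≤ CA.ncard + CP.ncard := by
  have := hK.ncard_cover CA CP hC
  omega

/-- Equality holds when the three defect terms in `IsMatchingSet.ncard_cover` vanish. -/
theorem IsMatchingSet.ncard_eq_cover_iff [Finite A] [Finite P] {K : Set (A × P)}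
    (hK : IsMatchingSet K) (CA : Set A) (CP : Set P) (hC : ∀ e ∈ K, e.1 ∈ CA ∨ e.2 ∈ CP) :
    K.ncard = CA.ncard + CP.ncard ↔ (∀ a ∈ CA, ¬ IsUnmatched K (.inl a)) ∧
      (∀ p ∈ CP, ¬ IsUnmatched K (.inr p)) ∧ ∀ e ∈ K, ¬ (e.1 ∈ CA ∧ e.2 ∈ CP) := by
  have h := hK.ncard_cover CA CP hC
  have h1 := Set.ncard_eq_zero (s := {e | e ∈ K ∧ e.1 ∈ CA ∧ e.2 ∈ CP})
  have h2 := Set.ncard_eq_zero (s := {a | a ∈ CA ∧ ∀ p, (a, p) ∉ K})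
  have h3 := Set.ncard_eq_zero (s := {p | p ∈ CP ∧ ∀ a, (a, p) ∉ K})
  simp only [Set.eq_empty_iff_forall_notMem, Set.mem_ofPred_eq, not_and] at h1 h2 h3
  simp only [isUnmatched_inl, isUnmatched_inr, not_and]
  rw [← h1, ← h2, ← h3]
  omega

/-- These are covers because all neighbours of an even vertex are odd. -/
theorem cover_of_subset {H N K : Set (A × P)} (hN : IsMatchingSet N) (hKH : K ⊆ H) (e : A × P) (he : e ∈ K) :
    (e.1 ∈ {a | ¬ AltReach H N true (.inl a)} ∨ e.2 ∈ {p | AltReach H N false (.inr p)}) ∧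
    (e.1 ∈ {a | AltReach H N false (.inl a)} ∨ e.2 ∈ {p | ¬ AltReach H N true (.inr p)}) := by
  have h' : (bipGraph H).Adj (.inl e.1) (.inr e.2) := by simpa using hKH he
  constructor
  · by_cases h : AltReach H N true (.inl e.1)
    · exact .inr (h.odd_of_adj hN h')
    · exact .inl h
  · by_cases h : AltReach H N true (.inr e.2)
    · exact .inl (h.odd_of_adj hN h'.symm)
    · exact .inr h

/-! ### Maximum matchings and the even/odd/unreachable classification -/

section Classification

variable [Finite A] [Finite P] {H N K : Set (A × P)}

/-- Both covers are tight: exposed vertices are even and not odd, and an `N`-edge leads from an odd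
vertex to an even one, so no `N`-edge is covered twice. -/
theorem ncard_eq_covers (hNH : N ⊆ H) (hN : IsMatchingSet N)
    (hd : ∀ v, AltReach H N true v → ¬ AltReach H N false v) :
    N.ncard = {a | ¬ AltReach H N true (.inl a)}.ncard +
      {p | AltReach H N false (.inr p)}.ncard ∧
    N.ncard = {a | AltReach H N false (.inl a)}.ncard +
      {p | ¬ AltReach H N true (.inr p)}.ncard := by
  have hedge : ∀ e ∈ N, (bipGraph N).Adj (.inl e.1) (.inr e.2) := fun e he => by simpa using he
  have hedge' : ∀ e ∈ N, (bipGraph H).Adj (.inl e.1) (.inr e.2) := fun e he => by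
    simpa using hNH he
  have hcov : ∀ v, ¬ AltReach H N true v → ¬ IsUnmatched N v := fun v h h' => h (.base h')
  have hcov' : ∀ v, AltReach H N false v → ¬ IsUnmatched N v :=
    fun v h h' => hd v (.base h') h
  constructor
  · rw [hN.ncard_eq_cover_iff]
    · exact ⟨fun a => hcov _, fun p => hcov' _, fun e he h => h.1 (h.2.back (hedge e he).symm)⟩
    · intro e he
      by_cases h : AltReach H N true (.inl e.1)
      · exact .inr (h.odd_of_adj hN (hedge' e he))
      · exact .inl h
  · rw [hN.ncard_eq_cover_iff]
    · exact ⟨fun a => hcov' _, fun p => hcov _, fun e he h => h.2 (h.1.back (hedge e he))⟩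
    · intro e he
      by_cases h : AltReach H N true (.inr e.2)
      · exact .inl (h.odd_of_adj hN (hedge' e he).symm)
      · exact .inr h

theorem isMaximumMatching_of_disjoint (hNH : N ⊆ H) (hN : IsMatchingSet N)
    (hd : ∀ v, AltReach H N true v → ¬ AltReach H N false v) : IsMaximumMatching H N := by
  refine ⟨hNH, hN, fun K hKH hK => ?_⟩
  rw [(ncard_eq_covers hNH hN hd).1]
  exact hK.ncard_le_cover _ _ (fun e he => (cover_of_subset hN hKH e he).1)

/-- A matching that is not maximum can be augmented without uncovering a vertex. -/
theorem exists_augmentation (hNH : N ⊆ H) (hN : IsMatchingSet N) (h : ¬ IsMaximumMatching H N) :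
    ∃ K ⊆ H, IsMatchingSet K ∧ N.ncard < K.ncard ∧ ∀ v, IsUnmatched K v → IsUnmatched N v := by
  by_contra hcon
  refine h (isMaximumMatching_of_disjoint hNH hN (not_altReach_both ?_))
  intro a ha hr
  obtain ⟨K, hKs, hK, hc, -, hu⟩ := hr.exists_augmentation hN ha
  exact hcon ⟨K, fun e he => (hKs he).elim (fun h => hNH h) id, hK, hc, hu⟩

theorem IsMaximumMatching.disjoint (hN : IsMaximumMatching H N) (v : A ⊕ P)
    (hv : AltReach H N true v) : ¬ AltReach H N false v := by
  refine not_altReach_both ?_ v hv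
  intro a ha hr
  obtain ⟨K, hKs, hK, hc, -⟩ := hr.exists_augmentation hN.2.1 ha
  exact absurd (hN.2.2 K (fun e he => (hKs he).elim (fun h => hN.1 h) id) hK) (by omega)

/-- The maximum matchings are those that cover all odd and unreachable vertices and use no edge
between an odd vertex and an odd or unreachable vertex. -/
theorem IsMaximumMatching.iff_covers (hN : IsMaximumMatching H N) (hKH : K ⊆ H)
    (hK : IsMatchingSet K) :
    IsMaximumMatching H K ↔ (∀ v, ¬ AltReach H N true v → ¬ IsUnmatched K v) ∧
      ∀ e ∈ K, ¬ (¬ AltReach H N true (.inl e.1) ∧ AltReach H N false (.inr e.2)) ∧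
        ¬ (AltReach H N false (.inl e.1) ∧ ¬ AltReach H N true (.inr e.2)) := by
  obtain ⟨h1, h2⟩ := ncard_eq_covers hN.1 hN.2.1 hN.disjoint
  have hmax : IsMaximumMatching H K ↔ K.ncard = N.ncard := by
    refine ⟨fun h => le_antisymm (hN.2.2 K hKH hK) (h.2.2 N hN.1 hN.2.1), fun h => ⟨hKH, hK, ?_⟩⟩
    rw [h]
    exact hN.2.2
  have k1 := hK.ncard_eq_cover_iff _ _ (fun e he => (cover_of_subset hN.2.1 hKH e he).1)
  have k2 := hK.ncard_eq_cover_iff _ _ (fun e he => (cover_of_subset hN.2.1 hKH e he).2)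
  rw [← h1] at k1
  rw [← h2] at k2
  rw [hmax]
  constructor
  · intro h
    obtain ⟨k11, -, k13⟩ := k1.1 h
    obtain ⟨-, k22, k23⟩ := k2.1 h
    refine ⟨?_, fun e he => ⟨k13 e he, k23 e he⟩⟩
    rintro (a | p)
    · exact k11 a
    · exact k22 p
  -- Tightness in the first cover is enough here; its odd posts are non-even by disjointness.
  · rintro ⟨h, h'⟩
    refine k1.2 ⟨fun a ha => h _ ha, fun p hp => h _ ?_, fun e he => (h' e he).1⟩
    exact fun h'' => hN.disjoint _ h'' hp

/-- Follow the `K`-walk with `N`-labels: `K` exposes only `N`-even vertices, and a `K`-edge at an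
odd vertex must end in an even one. -/
theorem IsMaximumMatching.altReach_imp (hN : IsMaximumMatching H N) (hK : IsMaximumMatching H K)
    {b : Bool} {v : A ⊕ P} (h : AltReach H K b v) : AltReach H N b v := by
  obtain ⟨hc, he⟩ := (hN.iff_covers hK.1 hK.2.1).1 hK
  induction h with
  | base h => exact by_contra fun h' => hc _ h' h
  | out _ h _ ih => exact ih.odd_of_adj hN.2.1 h
  | @back v w _ h ih =>
    by_contra hw
    rcases v with a | p <;> rcases w with b | q
    · simp at h
    · exact (he (a, q) (by simpa using h)).2 ⟨ih, hw⟩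
    · exact (he (b, p) (by simpa using h)).1 ⟨hw, ih⟩
    · simp at h

theorem IsMaximumMatching.altReach_iff (hN : IsMaximumMatching H N) (hK : IsMaximumMatching H K)
    {b : Bool} {v : A ⊕ P} : AltReach H K b v ↔ AltReach H N b v :=
  ⟨hN.altReach_imp hK, hK.altReach_imp hN⟩

end Classification

end Bipartite

section Bipartite

variable {A P : Type*} [Finite A] [Finite P] {H N : Set (A × P)}

theorem IsMaximumMatching.odd_or_unreachable_iff (hN : IsMaximumMatching H N) {v : A ⊕ P} :
    IsOddVertex H N v ∨ IsUnreachableVertex H N v ↔ ¬ AltReach H N true v := by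
  rw [isUnreachableVertex_iff, isOddVertex_iff hN.1, isEvenVertex_iff hN.1]
  have := hN.disjoint v
  tauto

end Bipartite

/-! ### Rank-maximal matchings through the stages -/

namespace PrefInstance

variable {A P : Type*} {J : PrefInstance A P} {N : ℕ → Set (A × P)} {K L M : Set (A × P)}

/-- The edges of rank at most `j` of an edge set. -/
def atMost (J : PrefInstance A P) (K : Set (A × P)) (j : ℕ) : Set (A × P) :=
  {e | e ∈ K ∧ J.rank e.1 e.2 ≤ j}

theorem atMost_subset {j : ℕ} : J.atMost K j ⊆ K := fun _ h => h.1

theorem atMost_eq_self {j : ℕ} (h : ∀ e ∈ K, J.rank e.1 e.2 ≤ j) : J.atMost K j = K :=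
  Set.Subset.antisymm atMost_subset fun e he => ⟨he, h e he⟩

theorem atMost_zero (hK : K ⊆ J.edges) : J.atMost K 0 = ∅ := by
  ext e
  simp only [atMost, Set.mem_ofPred_eq, Set.mem_empty_iff_false, iff_false, not_and]
  intro he
  have := J.one_le_rank _ _ (hK he)
  omega

theorem ncard_atMost_succ [Finite A] [Finite P] (j : ℕ) :
    (J.atMost K (j + 1)).ncard = (J.atMost K j).ncard + J.signature K (j + 1) := by
  rw [signature, ← Set.ncard_union_eq]
  · congr 1
    ext e
    simp only [atMost, Set.mem_union, Set.mem_ofPred_eq, ← and_or_left, Nat.le_succ_iff]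
  · rw [Set.disjoint_left]
    rintro e ⟨-, h⟩ ⟨-, h'⟩
    omega

/-- Signatures are compared through cumulative counts, which are the sizes of matchings in the stage
graphs. -/
theorem sigGreater_of_ncard_atMost [Finite A] [Finite P] {k : ℕ} (hk : k + 1 ≤ J.r)
    (hK : K ⊆ J.edges) (hL : L ⊆ J.edges)
    (heq : ∀ i, 1 ≤ i → i ≤ k → (J.atMost K i).ncard = (J.atMost L i).ncard)
    (hlt : (J.atMost L (k + 1)).ncard < (J.atMost K (k + 1)).ncard) : J.SigGreater K L := by
  have heq' : ∀ i ≤ k, (J.atMost K i).ncard = (J.atMost L i).ncard := by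
    intro i hi
    rcases Nat.eq_zero_or_pos i with rfl | h
    · rw [atMost_zero hK, atMost_zero hL]
    · exact heq i h hi
  refine ⟨k + 1, by omega, hk, ?_, ?_⟩
  · intro i h1 hi
    obtain ⟨i, rfl⟩ := Nat.exists_eq_succ_of_ne_zero (by omega : i ≠ 0)
    have h2 := heq' (i + 1) (by omega)
    rw [ncard_atMost_succ, ncard_atMost_succ, heq' i (by omega)] at h2
    exact Nat.add_left_cancel h2
  · rw [ncard_atMost_succ, ncard_atMost_succ, heq' k le_rfl] at hlt
    omega

theorem surviving_succ_subset (i : ℕ) : J.surviving N (i + 1) ⊆ J.surviving N i :=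
  fun _ h => h.1

theorem surviving_antitone : Antitone (J.surviving N) :=
  antitone_nat_of_succ_le surviving_succ_subset

theorem surviving_subset_edges (i : ℕ) : J.surviving N i ⊆ J.edges :=
  surviving_antitone (Nat.zero_le i)

theorem atMost_subset_stageGraph {i : ℕ} (hK : K ⊆ J.surviving N i) :
    J.atMost K i ⊆ J.stageGraph N i :=
  fun _ h => ⟨surviving_antitone (Nat.sub_le i 1) (hK h.1), h.2⟩

/-- The vertices of `G'_i` reached by even (flag `true`) or odd alternating walks. -/
def StageReach (J : PrefInstance A P) (N : ℕ → Set (A × P)) (i : ℕ) (b : Bool) (v : A ⊕ P) :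
    Prop :=
  AltReach (J.stageGraph N i) (N i) b v

theorem IsRun.evenAt_iff (hN : J.IsRun N) {i : ℕ} (h1 : 1 ≤ i) (hi : i ≤ J.r) {p : P} :
    J.EvenAt N i p ↔ J.StageReach N i true (.inr p) :=
  isEvenVertex_iff (hN i h1 hi).1

variable [Finite A] [Finite P]

theorem mem_surviving_iff {i : ℕ} (hi : 1 ≤ i) (hN : IsMaximumMatching (J.stageGraph N i) (N i))
    {e : A × P} :
    e ∈ J.surviving N i ↔ e ∈ J.surviving N (i - 1) ∧
      (i < J.rank e.1 e.2 →
        J.StageReach N i true (.inl e.1) ∧ J.StageReach N i true (.inr e.2)) ∧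
      (J.rank e.1 e.2 ≤ i →
        ¬ (¬ J.StageReach N i true (.inl e.1) ∧ J.StageReach N i false (.inr e.2)) ∧
        ¬ (J.StageReach N i false (.inl e.1) ∧ ¬ J.StageReach N i true (.inr e.2))) := by
  obtain ⟨i, rfl⟩ : ∃ k, i = k + 1 := ⟨i - 1, by omega⟩
  have hdef : ∀ e, e ∈ J.surviving N (i + 1) ↔ e ∈ J.surviving N i ∧
    (i + 1 < J.rank e.1 e.2 →
      ¬ ((IsOddVertex (J.stageGraph N (i + 1)) (N (i + 1)) (Sum.inl e.1) ∨
          IsUnreachableVertex (J.stageGraph N (i + 1)) (N (i + 1)) (Sum.inl e.1)) ∨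
        (IsOddVertex (J.stageGraph N (i + 1)) (N (i + 1)) (Sum.inr e.2) ∨
          IsUnreachableVertex (J.stageGraph N (i + 1)) (N (i + 1)) (Sum.inr e.2)))) ∧
    (J.rank e.1 e.2 ≤ i + 1 →
      ¬ ((IsOddVertex (J.stageGraph N (i + 1)) (N (i + 1)) (Sum.inl e.1) ∧
          (IsOddVertex (J.stageGraph N (i + 1)) (N (i + 1)) (Sum.inr e.2) ∨
          IsUnreachableVertex (J.stageGraph N (i + 1)) (N (i + 1)) (Sum.inr e.2))) ∨
         (IsOddVertex (J.stageGraph N (i + 1)) (N (i + 1)) (Sum.inr e.2) ∧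
          (IsOddVertex (J.stageGraph N (i + 1)) (N (i + 1)) (Sum.inl e.1) ∨
          IsUnreachableVertex (J.stageGraph N (i + 1)) (N (i + 1)) (Sum.inl e.1))))) :=
    fun e => Iff.rfl
  rw [hdef]
  simp only [hN.odd_or_unreachable_iff]
  simp only [isOddVertex_iff hN.1, Nat.add_sub_cancel, StageReach]
  tauto

/-- A matching of undeleted edges has as many edges of rank at most `j` as possible if and only if
it covers the odd and unreachable vertices of `G'_j`. -/
theorem isMaximumMatching_atMost_iff {j : ℕ} (hj : 1 ≤ j)
    (hN : IsMaximumMatching (J.stageGraph N j) (N j)) (hK : IsMatchingSet K)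
    (hKs : K ⊆ J.surviving N j) :
    IsMaximumMatching (J.stageGraph N j) (J.atMost K j) ↔
      ∀ v, ¬ J.StageReach N j true v → ¬ IsUnmatched K v := by
  rw [hN.iff_covers (atMost_subset_stageGraph hKs) (hK.mono atMost_subset)]
  constructor
  · rintro ⟨h, -⟩ v hv hu
    exact h v hv fun e he => hu e he.1
  · intro h
    refine ⟨?_, fun e he => ((mem_surviving_iff hj hN).1 (hKs he.1)).2.2 he.2⟩
    intro v hv hu
    refine h v hv fun e he => ?_
    by_cases hr : J.rank e.1 e.2 ≤ j
    · exact hu e ⟨he, hr⟩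
    -- Surviving edges of rank above `j` touch even vertices only, so they cannot be what covers
    -- `v`.
    · have := ((mem_surviving_iff hj hN).1 (hKs he)).2.1 (by omega)
      constructor
      · rintro rfl; exact hv this.1
      · rintro rfl; exact hv this.2

/-- An edge of `M` of rank above `i` at a non-even vertex would leave that vertex exposed by
`J.atMost M i`, against maximality. -/
theorem isMaximumMatching_atMost_of_covers {i : ℕ} (hi : 1 ≤ i)
    (hN : IsMaximumMatching (J.stageGraph N i) (N i)) (hM : IsMatchingSet M)
    (hMs : M ⊆ J.surviving N (i - 1))
    (hmax : IsMaximumMatching (J.stageGraph N i) (J.atMost M i)) : M ⊆ J.surviving N i := by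
  intro e he
  obtain ⟨hc, hb⟩ := (hN.iff_covers hmax.1 hmax.2.1).1 hmax
  refine (mem_surviving_iff hi hN).2 ⟨hMs he, fun hr => ⟨?_, ?_⟩, fun hr => hb e ⟨he, hr⟩⟩
  · by_contra h
    refine hc _ h (isUnmatched_inl.2 fun p hp => ?_)
    have := hM _ hp.1 _ he (.inl rfl)
    rw [this] at hp
    exact absurd hp.2 (by omega)
  · by_contra h
    refine hc _ h (isUnmatched_inr.2 fun p hp => ?_)
    have := hM _ hp.1 _ he (.inr rfl)
    rw [this] at hp
    exact absurd hp.2 (by omega)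

/-- A rank-maximal matching uses no deleted edge and is maximum in every graph `G'_j`. -/
theorem IsRankMaximal.subset_surviving (hN : J.IsRun N) (hM : J.IsRankMaximal M) {i : ℕ}
    (hi : i ≤ J.r) : M ⊆ J.surviving N i ∧
      ∀ j, 1 ≤ j → j ≤ i → IsMaximumMatching (J.stageGraph N j) (J.atMost M j) := by
  induction i with
  | zero => exact ⟨hM.1, fun j h1 h2 => by omega⟩
  | succ i ih =>
    obtain ⟨hs, hmax⟩ := ih (by omega)
    have hsub : J.atMost M (i + 1) ⊆ J.stageGraph N (i + 1) := fun e he => ⟨hs he.1, he.2⟩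
    have key : IsMaximumMatching (J.stageGraph N (i + 1)) (J.atMost M (i + 1)) := by
      -- The augmentation `K` exposes nothing new, so it stays maximum in all earlier stages and
      -- gains at rank `i + 1`. It drops the edges of `M` of higher rank, which is harmless
      -- lexicographically.
      by_contra hnot
      obtain ⟨K, hKs, hK, hlt, hKu⟩ := exists_augmentation hsub (hM.2.1.mono atMost_subset) hnot
      have hKs' : K ⊆ J.surviving N i := fun e he => (hKs he).1
      refine hM.2.2 K (hKs'.trans (surviving_subset_edges i)) hK
        (sigGreater_of_ncard_atMost hi (hKs'.trans (surviving_subset_edges i)) hM.1 ?_ ?_)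
      · intro j h1 hj
        have hNj := hN j h1 (by omega)
        have hKj : IsMaximumMatching (J.stageGraph N j) (J.atMost K j) := by
          rw [isMaximumMatching_atMost_iff h1 hNj hK (hKs'.trans (surviving_antitone hj))]
          intro v hv hu
          refine ((hNj.iff_covers (hmax j h1 hj).1 (hmax j h1 hj).2.1).1 (hmax j h1 hj)).1 v hv ?_
          intro e he
          exact hKu v hu e ⟨he.1, he.2.trans (by omega)⟩
        exact le_antisymm ((hmax j h1 hj).2.2 _ hKj.1 hKj.2.1)
          (hKj.2.2 _ (hmax j h1 hj).1 (hmax j h1 hj).2.1)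
      · rwa [atMost_eq_self (K := K) fun e he => (hKs he).2]
    refine ⟨isMaximumMatching_atMost_of_covers (by omega) (hN _ (by omega) hi) hM.2.1 hs key, ?_⟩
    intro j h1 hj
    rcases Nat.le_succ_iff.1 hj with h | rfl
    · exact hmax j h1 h
    · exact key

/-- Posts left unmatched by a rank-maximal matching are even in all iterations. -/
theorem IsRankMaximal.evenAt_of_unmatched (hN : J.IsRun N) (hM : J.IsRankMaximal M) {p : P}
    (hp : ∀ a, (a, p) ∉ M) {i : ℕ} (h1 : 1 ≤ i) (hi : i ≤ J.r) : J.EvenAt N i p := by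
  rw [hN.evenAt_iff h1 hi]
  by_contra h
  obtain ⟨hs, hmax⟩ := hM.subset_surviving hN hi
  exact (isMaximumMatching_atMost_iff h1 (hN i h1 hi) hM.2.1 hs).1 (hmax i h1 le_rfl) _ h
    (isUnmatched_inr.2 hp)

theorem IsRankMaximal.isSink_of_unmatched (hN : J.IsRun N) (hM : J.IsRankMaximal M) {p : P}
    (hp : ∀ a, (a, p) ∉ M) : J.IsSink N M p :=
  ⟨fun _ ⟨a, ha, _⟩ => hp a ha, fun _ h1 hi => hM.evenAt_of_unmatched hN hp h1 hi⟩

/-- A matched post carries a loop in the switching graph, since `M` lies in the reduced graph. -/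
theorem IsRankMaximal.isSink_iff (hN : J.IsRun N) (hM : J.IsRankMaximal M) {p : P} :
    J.IsSink N M p ↔ ∀ a, (a, p) ∉ M :=
  ⟨fun h a ha => h.1 p ⟨a, ha, (hM.subset_surviving hN le_rfl).1 ha⟩, hM.isSink_of_unmatched hN⟩

end PrefInstance

namespace PrefInstance

variable {A P : Type*} {J : PrefInstance A P} {N : ℕ → Set (A × P)} {K L M : Set (A × P)}

theorem reducedGraph_rank_le {e : A × P} (he : e ∈ J.reducedGraph N) : J.rank e.1 e.2 ≤ J.r :=
  J.rank_le _ _ (surviving_subset_edges _ he)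

theorem reducedGraph_subset_stageGraph : J.reducedGraph N ⊆ J.stageGraph N J.r :=
  fun _ he => ⟨surviving_antitone (Nat.sub_le _ _) he, reducedGraph_rank_le he⟩

theorem reachable_of_switchingGraph_adj {p q : P} (h : (J.switchingGraph N M).Adj p q) :
    (J.underlyingGraph N M).Reachable p q := by
  by_cases hpq : p = q
  · rw [hpq]
  · exact SimpleGraph.Adj.reachable ⟨hpq, .inl h⟩

theorem exists_sinkComponent_iff {p : P} :
    (∃ X : (J.underlyingGraph N M).ConnectedComponent, p ∈ X.supp ∧ J.IsSinkComponent N M X) ↔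
      ∃ q, J.IsSink N M q ∧ (J.underlyingGraph N M).Reachable p q := by
  constructor
  · rintro ⟨X, hp, q, hq, hs⟩
    rw [SimpleGraph.ConnectedComponent.mem_supp_iff] at hp hq
    exact ⟨q, hs, SimpleGraph.ConnectedComponent.exact (hp.trans hq.symm)⟩
  · rintro ⟨q, hs, h⟩
    exact ⟨(J.underlyingGraph N M).connectedComponentMk p, rfl, q,
      SimpleGraph.ConnectedComponent.sound h.symm, hs⟩

/-! ### Sink and non-sink components -/

section Components

variable [Finite A] [Finite P]

theorem IsRankMaximal.subset_reducedGraph (hN : J.IsRun N) (hM : J.IsRankMaximal M) :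
    M ⊆ J.reducedGraph N :=
  (hM.subset_surviving hN le_rfl).1

theorem IsRankMaximal.isMaximumMatching (hN : J.IsRun N) (hM : J.IsRankMaximal M)
    (hr : 1 ≤ J.r) : IsMaximumMatching (J.stageGraph N J.r) M := by
  have h := (hM.subset_surviving hN le_rfl).2 J.r hr le_rfl
  rwa [atMost_eq_self fun e he => J.rank_le _ _ (hM.1 he)] at h

theorem IsRankMaximal.stageReach_iff (hN : J.IsRun N) (hM : J.IsRankMaximal M) (hr : 1 ≤ J.r)
    {b : Bool} {v : A ⊕ P} :
    J.StageReach N J.r b v ↔ AltReach (J.stageGraph N J.r) M b v :=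
  (hM.isMaximumMatching hN hr).altReach_iff (hN _ hr le_rfl)

/-- If all applicants are matched, then no post is odd in the last iteration. -/
theorem IsRankMaximal.not_stageReach_post (hN : J.IsRun N) (hM : J.IsRankMaximal M)
    (hr : 1 ≤ J.r) (hA : ∀ a, ∃ p, (a, p) ∈ M) (p : P) :
    ¬ J.StageReach N J.r false (.inr p) := by
  rw [hM.stageReach_iff hN hr]
  -- All walks start at posts, so the parity determines the side.
  have key : ∀ {b v}, AltReach (J.stageGraph N J.r) M b v → v.isLeft = !b := by
    intro b v h
    induction h with
    | @base v h =>
      rcases v with a | p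
      · obtain ⟨p, hp⟩ := hA a
        exact absurd hp (isUnmatched_inl.1 h p)
      · rfl
    | out _ h _ ih => simp [bipGraph_isLeft h.symm, ih]
    | back _ h ih => simp [bipGraph_isLeft h.symm, ih]
  intro h
  simpa using key h

theorem IsRun.even_iff_odd (hN : J.IsRun N) (hr : 1 ≤ J.r) {a : A} {q : P}
    (h : (a, q) ∈ J.reducedGraph N) :
    J.StageReach N J.r true (.inr q) ↔ J.StageReach N J.r false (.inl a) := by
  have hNr := hN _ hr le_rfl
  refine ⟨fun hq => hq.odd_of_adj hNr.2.1 (by simpa using reducedGraph_subset_stageGraph h), ?_⟩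
  intro ha
  by_contra hq
  exact (((mem_surviving_iff hr hNr).1 h).2.2 (reducedGraph_rank_le h)).2 ⟨ha, hq⟩

/-- The ends of a switching edge are neighbours in `G'` of one applicant, and each is even iff that
applicant is odd. -/
theorem IsRankMaximal.even_iff_of_reachable (hN : J.IsRun N) (hM : J.IsRankMaximal M)
    (hr : 1 ≤ J.r) {p q : P} (h : (J.underlyingGraph N M).Reachable p q) :
    J.StageReach N J.r true (.inr p) ↔ J.StageReach N J.r true (.inr q) := by
  have key : ∀ {p q}, (J.switchingGraph N M).Adj p q →
      (J.StageReach N J.r true (.inr p) ↔ J.StageReach N J.r true (.inr q)) := by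
    rintro p q ⟨a, hp, hq⟩
    rw [hN.even_iff_odd hr (hM.subset_reducedGraph hN hp), hN.even_iff_odd hr hq]
  obtain ⟨W⟩ := h
  induction W with
  | nil => rfl
  | cons h _ ih =>
    refine Iff.trans ?_ ih
    rcases h.2 with h | h
    · exact key h
    · exact (key h).symm

theorem IsRankMaximal.reachable_sink_of_even (hN : J.IsRun N) (hM : J.IsRankMaximal M)
    (hr : 1 ≤ J.r) {p : P} (hp : J.StageReach N J.r true (.inr p)) :
    ∃ q, J.IsSink N M q ∧ (J.underlyingGraph N M).Reachable p q := by
  rw [hM.stageReach_iff hN hr] at hp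
  have key : ∀ {b v}, AltReach (J.stageGraph N J.r) M b v →
      (∀ p, v = .inr p → b = true →
        ∃ q, J.IsSink N M q ∧ (J.underlyingGraph N M).Reachable p q) ∧
      (∀ a, v = .inl a → b = false → ∀ p, (a, p) ∈ M →
        ∃ q, J.IsSink N M q ∧ (J.underlyingGraph N M).Reachable p q) := by
    intro b v h
    induction h with
    | base h =>
      refine ⟨?_, by simp⟩
      rintro p rfl -
      exact ⟨p, hM.isSink_of_unmatched hN (isUnmatched_inr.1 h), .rfl⟩
    | @out v w hv h _ ih =>
      refine ⟨by simp, ?_⟩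
      rintro a rfl - p' hp'
      rcases v with b | p
      · simp at h
      obtain ⟨q, hq, hpq⟩ := ih.1 p rfl rfl
      refine ⟨q, hq, .trans (reachable_of_switchingGraph_adj ⟨a, hp', ?_⟩) hpq⟩
      rw [bipGraph_adj_inr_inl] at h
      have hev := (hM.stageReach_iff hN hr).2 hv
      have hNr := hN _ hr le_rfl
      -- The last deletion spares edges at an even post whose rank is within the stage.
      refine (mem_surviving_iff hr hNr).2 ⟨h.1, fun hlt => absurd h.2 (by omega), fun _ => ?_⟩
      exact ⟨fun h' => hNr.disjoint _ hev h'.2, fun h' => h'.2 hev⟩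
    | @back v w _ h ih =>
      refine ⟨?_, by simp⟩
      rintro p rfl -
      rcases v with a | q
      · exact ih.2 a rfl rfl p (by simpa using h)
      · simp at h
  exact (key hp).1 p rfl rfl

theorem IsRankMaximal.exists_sinkComponent_iff_evenAt (hN : J.IsRun N) (hM : J.IsRankMaximal M)
    (hr : 1 ≤ J.r) {p : P} :
    (∃ X : (J.underlyingGraph N M).ConnectedComponent, p ∈ X.supp ∧ J.IsSinkComponent N M X) ↔
      J.EvenAt N J.r p := by
  rw [exists_sinkComponent_iff, hN.evenAt_iff hr le_rfl]
  refine ⟨?_, hM.reachable_sink_of_even hN hr⟩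
  rintro ⟨q, hq, h⟩
  rw [hM.even_iff_of_reachable hN hr h, ← hN.evenAt_iff hr le_rfl]
  exact hq.2 _ hr le_rfl

theorem IsRankMaximal.exists_nonSinkComponent_iff_unreachableAt (hN : J.IsRun N)
    (hM : J.IsRankMaximal M) (hr : 1 ≤ J.r) (hA : ∀ a, ∃ p, (a, p) ∈ M) {p : P} :
    (∃ X : (J.underlyingGraph N M).ConnectedComponent, p ∈ X.supp ∧ ¬ J.IsSinkComponent N M X) ↔
      J.UnreachableAt N J.r p := by
  have h1 : (∃ X : (J.underlyingGraph N M).ConnectedComponent,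
      p ∈ X.supp ∧ ¬ J.IsSinkComponent N M X) ↔ ¬ J.EvenAt N J.r p := by
    rw [← hM.exists_sinkComponent_iff_evenAt hN hr]
    simp [SimpleGraph.ConnectedComponent.mem_supp_iff]
  have h2 : ¬ IsOddVertex (J.stageGraph N J.r) (N J.r) (.inr p) := by
    rw [isOddVertex_iff (hN _ hr le_rfl).1]
    exact hM.not_stageReach_post hN hr hA p
  rw [h1, UnreachableAt, isUnreachableVertex_iff, EvenAt]
  tauto

end Components

/-! ### Weights and switching along a path -/

section Switching

theorem weight_eq (hM : IsMatchingSet M) {a : A} {p : P} (h : (a, p) ∈ M) (q : P) :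
    J.weight M p q = (J.rank a q : ℤ) - J.rank a p := by
  have hex : ∃ a, (a, p) ∈ M := ⟨a, h⟩
  have hch : hex.choose = a := congrArg Prod.fst (hM _ hex.choose_spec _ h (.inr rfl))
  rw [weight, dif_pos hex, hch]

theorem pathWeight_cons_cons (p q : P) (T : List P) :
    J.pathWeight M (p :: q :: T) = J.weight M p q + J.pathWeight M (q :: T) := by
  simp [pathWeight]

/-- This turns a rank into a count of thresholds, so that weights become differences of cumulative
counts. -/
theorem sum_range_indicator_le {x R : ℕ} (h : x ≤ R) :
    ∑ i ∈ Finset.range R, (if x ≤ i then 1 else 0 : ℤ) = R - x := by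
  rw [Finset.sum_boole, ← Nat.cast_sub h, ← Nat.card_Ico x R]
  congr 2
  ext i
  simp only [Finset.mem_filter, Finset.mem_range, Finset.mem_Ico]
  omega

variable [Finite A] [Finite P]

theorem ncard_atMost_insert {e : A × P} (he : e ∉ K) (i : ℕ) :
    (J.atMost (insert e K) i).ncard =
      (J.atMost K i).ncard + if J.rank e.1 e.2 ≤ i then 1 else 0 := by
  split_ifs with h
  · rw [← Set.ncard_insert_of_notMem (s := J.atMost K i) (fun h' => he h'.1)]
    congr 1
    ext f
    simp only [atMost, Set.mem_insert_iff, Set.mem_ofPred_eq]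
    constructor
    · rintro ⟨rfl | h1, h2⟩
      · exact .inl rfl
      · exact .inr ⟨h1, h2⟩
    · rintro (rfl | ⟨h1, h2⟩)
      · exact ⟨.inl rfl, h⟩
      · exact ⟨.inr h1, h2⟩
  · rw [add_zero]
    congr 1
    ext f
    simp only [atMost, Set.mem_insert_iff, Set.mem_ofPred_eq]
    constructor
    · rintro ⟨rfl | h1, h2⟩
      · exact absurd h2 h
      · exact ⟨h1, h2⟩
    · rintro ⟨h1, h2⟩
      exact ⟨.inr h1, h2⟩

/-- Switching a matching along a directed path of the switching graph that ends in an unmatched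
post. -/
theorem exists_switch (hM : IsMatchingSet M) (hMs : M ⊆ J.reducedGraph N) {p q : P} {T : List P}
    (hT : J.IsSwitchPath N M p q T) (hq : ∀ a, (a, q) ∉ M) :
    ∃ K ⊆ J.reducedGraph N, IsMatchingSet K ∧ (∀ x ∉ T, ∀ b, (b, x) ∈ K ↔ (b, x) ∈ M) ∧
      (∀ v, v ≠ .inr p → IsUnmatched K v → IsUnmatched M v) ∧ IsUnmatched K (.inr p) ∧
      K.ncard = M.ncard ∧
      J.pathWeight M T =
        ∑ i ∈ Finset.range J.r, (((J.atMost M i).ncard : ℤ) - (J.atMost K i).ncard) := by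
  induction T generalizing p with
  | nil => simp [IsSwitchPath] at hT
  | cons p₀ T ih =>
  obtain ⟨hch, hnd, hhd, hlast⟩ := hT
  obtain rfl : p₀ = p := by simpa using hhd
  cases T with
  | nil =>
    obtain rfl : p₀ = q := by simpa using hlast
    exact ⟨M, hMs, hM, by simp, fun _ _ h => h, isUnmatched_inr.2 hq, rfl, by simp [pathWeight]⟩
  | cons p₁ T =>
  rw [List.isChain_cons_cons] at hch
  obtain ⟨⟨a, hap, hap₁⟩, hch⟩ := hch
  rw [List.nodup_cons] at hnd
  -- Switching the tail first frees `p₁` and leaves the edge at `p₀` alone, as `p₀` is not on the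
  -- tail; then `a` moves from `p₀` to `p₁`.
  obtain ⟨K, hKs, hK, hKT, hKu, hKp, hKc, hKw⟩ :=
    ih (p := p₁) ⟨hch, hnd.2, rfl, by simpa using hlast⟩
  have hapK : (a, p₀) ∈ K := (hKT p₀ hnd.1 a).2 hap
  set L := K \ {(a, p₀)} with hL
  have hKL : insert (a, p₀) L = K := Set.insert_sdiff_self_of_mem hapK
  have haL : ∀ x, (a, x) ∉ L := fun x hx => hx.2 (hK _ hx.1 _ hapK (.inl rfl))
  have hpL : ∀ b, (b, p₀) ∉ L := fun b hb => hb.2 (hK _ hb.1 _ hapK (.inr rfl))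
  have hp₁L : ∀ b, (b, p₁) ∉ L := fun b hb => isUnmatched_inr.1 hKp b hb.1
  have hne : p₀ ≠ p₁ := by rintro rfl; exact hnd.1 (by simp)
  refine ⟨insert (a, p₁) L, ?_, (hK.mono Set.sdiff_subset).insert haL hp₁L, ?_, ?_, ?_, ?_, ?_⟩
  · rintro e (rfl | he)
    · exact hap₁
    · exact hKs he.1
  · intro x hx b
    rw [← hKT x (fun h => hx (List.mem_cons_of_mem _ h)), ← hKL]
    simp only [List.mem_cons, not_or] at hx
    simp [hx.1, hx.2.1]
  · intro v hv hu
    have hva : v ≠ .inl a ∧ v ≠ .inr p₁ := hu (a, p₁) (.inl rfl)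
    refine hKu v hva.2 fun e he => ?_
    rw [← hKL] at he
    rcases he with rfl | he
    · exact ⟨hva.1, hv⟩
    · exact hu e (.inr he)
  · rw [isUnmatched_inr]
    rintro b (hb | hb)
    · exact hne (Prod.mk.injEq .. ▸ hb).2
    · exact hpL b hb
  · rw [← hKc, ← hKL, Set.ncard_insert_of_notMem (hp₁L a), Set.ncard_insert_of_notMem (hpL a)]
  · rw [pathWeight_cons_cons, hKw, weight_eq hM hap]
    have h1 := sum_range_indicator_le (J.rank_le _ _ (surviving_subset_edges _ hap₁))
    have h0 := sum_range_indicator_le (J.rank_le _ _ (surviving_subset_edges _ (hMs hap)))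
    have hdiff : (J.rank a p₁ : ℤ) - J.rank a p₀ =
        ∑ i ∈ Finset.range J.r, ((if J.rank a p₀ ≤ i then 1 else 0 : ℤ) -
          (if J.rank a p₁ ≤ i then 1 else 0 : ℤ)) := by
      rw [Finset.sum_sub_distrib, h1, h0]
      ring
    rw [hdiff, ← Finset.sum_add_distrib]
    refine Finset.sum_congr rfl fun i _ => ?_
    rw [← hKL, ncard_atMost_insert (hpL a), ncard_atMost_insert (hp₁L a)]
    push_cast
    ring

theorem IsRankMaximal.pathWeight_eq_zero_iff (hN : J.IsRun N) (hM : J.IsRankMaximal M)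
    {p q : P} {T : List P} (hq : J.IsSink N M q) (hT : J.IsSwitchPath N M p q T) :
    J.pathWeight M T = 0 ↔ J.AlwaysEven N p := by
  obtain ⟨K, hKs, hK, -, hKu, hKp, hKc, hKw⟩ :=
    exists_switch hM.2.1 (hM.subset_reducedGraph hN) hT ((hM.isSink_iff hN).1 hq)
  have hKs' : ∀ {i}, i ≤ J.r → K ⊆ J.surviving N i :=
    fun hi => hKs.trans (surviving_antitone hi)
  have hmax := (hM.subset_surviving hN le_rfl).2
  have hle : ∀ i, 1 ≤ i → i ≤ J.r → (J.atMost K i).ncard ≤ (J.atMost M i).ncard :=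
    fun i h1 hi => (hmax i h1 hi).2.2 _ (atMost_subset_stageGraph (hKs' hi)) (hK.mono atMost_subset)
  have hev : ∀ i, 1 ≤ i → i ≤ J.r →
      ((J.atMost K i).ncard = (J.atMost M i).ncard ↔ J.EvenAt N i p) := by
    intro i h1 hi
    have hmi := hmax i h1 hi
    have heq : (J.atMost K i).ncard = (J.atMost M i).ncard ↔
        IsMaximumMatching (J.stageGraph N i) (J.atMost K i) := by
      refine ⟨fun h => ⟨atMost_subset_stageGraph (hKs' hi), hK.mono atMost_subset, ?_⟩, fun h => ?_⟩
      · rw [h]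
        exact hmi.2.2
      · exact le_antisymm (hle i h1 hi) (h.2.2 _ hmi.1 hmi.2.1)
    rw [heq, isMaximumMatching_atMost_iff h1 (hN i h1 hi) hK (hKs' hi), hN.evenAt_iff h1 hi]
    constructor
    · intro h
      by_contra hp
      exact h _ hp hKp
    -- Only `p` can be exposed by `K` but not by `M`, and `p` is even here.
    · intro hp v hv hu
      refine (isMaximumMatching_atMost_iff h1 (hN i h1 hi) hM.2.1
        (hM.subset_surviving hN hi).1).1 hmi v hv (hKu v ?_ hu)
      rintro rfl
      exact hv hp
  have h0 : (J.atMost K 0).ncard = (J.atMost M 0).ncard := by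
    rw [atMost_zero hM.1, atMost_zero (hKs.trans (surviving_subset_edges _))]
  have hle' : ∀ i ∈ Finset.range J.r,
      0 ≤ ((J.atMost M i).ncard : ℤ) - (J.atMost K i).ncard := by
    intro i hi
    rw [Finset.mem_range] at hi
    rcases Nat.eq_zero_or_pos i with rfl | h1
    · rw [h0, sub_self]
    · have := hle i h1 hi.le
      omega
  rw [hKw, Finset.sum_eq_zero_iff_of_nonneg hle']
  constructor
  · intro h i h1 hi
    rw [← hev i h1 hi]
    rcases hi.lt_or_eq with hi | rfl
    · have := h i (Finset.mem_range.2 hi)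
      omega
    -- The sum omits `i = J.r`, where the counts agree because `K` and `M` have equal size.
    · rw [atMost_eq_self fun e he => reducedGraph_rank_le (hKs he),
        atMost_eq_self fun e he => J.rank_le _ _ (hM.1 he), hKc]
  · intro h i hi
    rw [Finset.mem_range] at hi
    rcases Nat.eq_zero_or_pos i with rfl | h1
    · rw [h0, sub_self]
    · rw [(hev i h1 hi.le).2 (h i h1 hi.le), sub_self]

end Switching

/-- Thanks to the last resorts, rank-maximal matchings match all applicants. -/
theorem IsRankMaximal.exists_post [Finite A] [Finite P] {I : PrefInstance A P}
    {M : Set (A × (P ⊕ A))} (hM : I.withLastResorts.IsRankMaximal M) (a : A) :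
    ∃ p, (a, p) ∈ M := by
  by_contra! ha
  have hp : ∀ b, (b, (Sum.inr a : P ⊕ A)) ∉ M := by
    intro b hb
    obtain rfl : a = b := hM.1 hb
    exact ha _ hb
  have hrank : I.withLastResorts.rank a (.inr a) = I.r + 1 := rfl
  have hsub : insert (a, .inr a) M ⊆ I.withLastResorts.edges := by
    rintro e (rfl | he)
    · exact (rfl : a = a)
    · exact hM.1 he
  -- Adding the last-resort edge changes only the final signature entry, at rank `I.r + 1`.
  refine hM.2.2 _ hsub (hM.2.1.insert ha hp)
    (sigGreater_of_ncard_atMost (k := I.r) le_rfl hsub hM.1 ?_ ?_)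
  · intro i _ hi
    rw [ncard_atMost_insert (ha _), hrank, if_neg (by omega), add_zero]
  · rw [ncard_atMost_insert (ha _), hrank, if_pos le_rfl]
    omega

end PrefInstance

theorem mainTheorem4 {A P : Type*} [Finite A] [Finite P] (I : PrefInstance A P)
    (G : PrefInstance A (P ⊕ A)) (hG : G = I.withLastResorts)
    (N : ℕ → Set (A × (P ⊕ A))) (hN : G.IsRun N)
    (M : Set (A × (P ⊕ A))) (hM : G.IsRankMaximal M) :
    (∀ p : P ⊕ A, (∀ a, (a, p) ∉ M) →
      (∀ i, 1 ≤ i → i ≤ I.r + 1 → G.EvenAt N i p) ∧ G.IsSink N M p) ∧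
    (∀ p : P ⊕ A,
      ((∃ X : (G.underlyingGraph N M).ConnectedComponent,
          p ∈ X.supp ∧ G.IsSinkComponent N M X) ↔ G.EvenAt N (I.r + 1) p) ∧
      ((∃ X : (G.underlyingGraph N M).ConnectedComponent,
          p ∈ X.supp ∧ ¬ G.IsSinkComponent N M X) ↔ G.UnreachableAt N (I.r + 1) p)) ∧
    (∀ (p q : P ⊕ A) (T : List (P ⊕ A)), G.IsSink N M q → G.IsSwitchPath N M p q T →
      (G.pathWeight M T = 0 ↔ ∀ i, 1 ≤ i → i ≤ I.r + 1 → G.EvenAt N i p)) := by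
  subst hG
  have hr : 1 ≤ I.withLastResorts.r := Nat.le_add_left 1 I.r
  refine ⟨fun p hp => ⟨fun i h1 hi => hM.evenAt_of_unmatched hN hp h1 hi,
    hM.isSink_of_unmatched hN hp⟩, fun p => ⟨hM.exists_sinkComponent_iff_evenAt hN hr,
    hM.exists_nonSinkComponent_iff_unreachableAt hN hr hM.exists_post⟩, fun p q T hq hT =>
    hM.pathWeight_eq_zero_iff hN hq hT⟩
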